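/- Let $p$ be a prime and $n\ge 0$. Write $[a,b]=\{x\in\mathbb Z : a\le x\le b\}$, let $\phi$ be Euler's function, let $\delta$ be Kronecker's delta, and for $j\in\mathbb Z$, $m\ge 1$ let $[j]_m\in[0,m-1]$ be the residue of $j$ modulo $m$. Let $C_{p^n}$ be a cyclic group of order $p^n$ with generator $c$, and for $i\in[0,n]$ let $\zeta_{p^i}$ be a primitive $p^i$-th root of unity over $\mathbb Q$. Let $$\omega:\ \mathbb Z C_{p^n}\to\prod_{i\in[0,n]}\mathbb Z[\zeta_{p^i}],\qquad c\mapsto(\zeta_{p^i})_{i\in[0,n]},$$ be the absolute cyclic Wedderburn embedding (a ring homomorphism). For a finitely supported sequence $x=(x_j)_{j\in\mathbb Z}$ of integers and $i,m,s\ge 0$ define the finitely supported sequence $T_i^{m,s}x$ by $$(T_i^{m,s}x)_j=\sum_{k\in\mathbb Z}x_{[j]_{p^{i-m}}-p^{i-m}+kp^{i+s}}\quad\text{if } i\ge m \text{ and } j\in[0,p^i-1],$$ and $(T_i^{m,s}x)_j=0$ otherwise. Put $x*\zeta_{p^i}=\sum_{j\in\mathbb Z}x_j\zeta_{p^i}^j$.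 **Theorem.** 1. The image of $\omega$ is the set of all tuples $\bigl(\sum_{j\in[0,\phi(p^i)-1]}x_{i,j}\zeta_{p^i}^j\bigr)_{i\in[0,n]}$ with $x_{i,j}\in\mathbb Z$ such that for all $l\in[1,n]$ and $j\in[0,\phi(p^{n-l})-1]$ $$x_{n-l,j}\equiv\sum_{i\in[0,l-1]}p^{l-1-i}\sum_{k\in[1,p-1]}\Bigl(x_{n-i,\;j-p^{n-l}+kp^{n-1-i}}-(1-\delta_{l,n})\,x_{n-i,\;[j]_{p^{n-l-1}}-p^{n-l-1}+kp^{n-1-i}}\Bigr)\pmod{p^l}$$ (for $l=n$ the second term is absent). 2. The image of $\omega$ is also the set of all tuples $(x_i*\zeta_{p^i})_{i\in[0,n]}$, where the $x_i$ are finitely supported integer sequences with support in $[0,\phi(p^i)-1]$ such that for all $l\in[1,n]$, entrywise, $$x_{n-l}\equiv\sum_{i\in[0,l-1]}p^{l-1-i}\bigl(T_{n-l}^{0,l-1-i}-T_{n-l}^{1,l-1-i}\bigr)x_{n-i}\pmod{p^l}.$$ 3. The system of congruences in 1 is triangular: the right-hand side of the congruence for $x_{n-l,j}$ depends only on the coefficients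 $x_{m,j'}$ with $m\in[n-l+1,n]$ and $j'\in[0,\phi(p^m)-1]$. 4. The elementary divisors of $\omega$ over $\mathbb Z$ are $p^i$ with multiplicity $\phi(p^{n-i})$, $i\in[0,n]$; that is, with respect to suitable $\mathbb Z$-bases of source and target, $\omega$ is given by the diagonal matrix with these diagonal entries. -/

import Mathlib

/-! The ring `ℤ[ζ_{p^i}]` is `Algebra.adjoin ℤ {ζ i}`, where `ζ i` is a primitive `p^i`-th root of
unity in a field `K` of characteristic zero; `∏_{i ∈ [0,n]} ℤ[ζ_{p^i}]` is indexed by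
`Fin (n + 1)`. -/

/-- The product `∏_{i ∈ [0,n]} ℤ[ζ i]`. -/
abbrev CycloProd {K : Type*} [Field K] (n : ℕ) (ζ : ℕ → K) : Type _ :=
  (i : Fin (n + 1)) → Algebra.adjoin ℤ ({ζ i} : Set K)

/-- The tuple `(ζ i)_{i ∈ [0,n]}`. -/
def zetaTuple {K : Type*} [Field K] (n : ℕ) (ζ : ℕ → K) : CycloProd n ζ :=
  fun i => ⟨ζ i, Algebra.subset_adjoin (Set.mem_singleton _)⟩

theorem zetaTuple_pow {K : Type*} [Field K] {p n : ℕ} {ζ : ℕ → K}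
    (hζ : ∀ i ≤ n, IsPrimitiveRoot (ζ i) (p ^ i)) : zetaTuple n ζ ^ p ^ n = 1 := by
  funext i
  apply Subtype.ext
  have hi : (i : ℕ) ≤ n := Nat.lt_succ_iff.mp i.2
  have h : ζ i ^ p ^ n = 1 := ((hζ i hi).pow_eq_one_iff_dvd _).2 (pow_dvd_pow p hi)
  simpa [zetaTuple] using h

/-- The tuple `(ζ i)_{i ∈ [0,n]}` as a unit. -/
def zetaUnit {K : Type*} [Field K] {p n : ℕ} (hp : p.Prime) {ζ : ℕ → K}
    (hζ : ∀ i ≤ n, IsPrimitiveRoot (ζ i) (p ^ i)) : (CycloProd n ζ)ˣ :=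
  Units.ofPowEqOne (zetaTuple n ζ) (p ^ n) (zetaTuple_pow hζ) (pow_pos hp.pos n).ne'

theorem orderOf_zetaUnit_dvd {K : Type*} [Field K] {p n : ℕ} (hp : p.Prime) {ζ : ℕ → K}
    (hζ : ∀ i ≤ n, IsPrimitiveRoot (ζ i) (p ^ i)) {G : Type*} [Group G] {c : G}
    (hc : ∀ g : G, g ∈ Subgroup.zpowers c) (hG : Nat.card G = p ^ n) :
    orderOf (zetaUnit hp hζ) ∣ orderOf c := by
  rw [orderOf_eq_card_of_forall_mem_zpowers hc, hG]
  exact orderOf_dvd_of_pow_eq_one (Units.pow_ofPowEqOne _ _)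

/-- The absolute cyclic Wedderburn embedding `ℤ C_{p^n} → ∏_{i ∈ [0,n]} ℤ[ζ_{p^i}]`, the ring
homomorphism that sends the generator `c` of the cyclic group `G = C_{p^n}` to
`(ζ_{p^i})_{i ∈ [0,n]}` (see `wedderburn_gen`). -/
noncomputable def wedderburn {K : Type*} [Field K] {p n : ℕ} (hp : p.Prime) {ζ : ℕ → K}
    (hζ : ∀ i ≤ n, IsPrimitiveRoot (ζ i) (p ^ i)) {G : Type*} [Group G] {c : G}
    (hc : ∀ g : G, g ∈ Subgroup.zpowers c) (hG : Nat.card G = p ^ n) :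
    MonoidAlgebra ℤ G →ₐ[ℤ] CycloProd n ζ :=
  MonoidAlgebra.lift ℤ (CycloProd n ζ) G
    ((Units.coeHom (CycloProd n ζ)).comp
      (monoidHomOfForallMemZpowers hc (orderOf_zetaUnit_dvd hp hζ hc hG)))

theorem wedderburn_gen {K : Type*} [Field K] {p n : ℕ} (hp : p.Prime) {ζ : ℕ → K}
    (hζ : ∀ i ≤ n, IsPrimitiveRoot (ζ i) (p ^ i)) {G : Type*} [Group G] {c : G}
    (hc : ∀ g : G, g ∈ Subgroup.zpowers c) (hG : Nat.card G = p ^ n) :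
    wedderburn hp hζ hc hG (MonoidAlgebra.of ℤ G c) = zetaTuple n ζ := by
  have h : ((monoidHomOfForallMemZpowers hc (orderOf_zetaUnit_dvd hp hζ hc hG) c :
      (CycloProd n ζ)ˣ) : CycloProd n ζ) = zetaTuple n ζ := by
    rw [monoidHomOfForallMemZpowers_apply_gen]
    rfl
  simpa [wedderburn] using h

/-- The right hand side of the tie for the coefficient `x_{n-l,j}`. The entry `x_{i,j}` is `x i j`;
for `1 ≤ l ≤ n` and `j ∈ [0, φ(p^{n-l}) - 1]`, only entries `x_{i,j'}` with `i ∈ [n-l+1, n]` and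
`j' ∈ [0, φ(p^i) - 1]` occur. -/
def tieSum (p n : ℕ) (x : ℕ → ℤ → ℤ) (l : ℕ) (j : ℤ) : ℤ :=
  ∑ i ∈ Finset.range l, (p : ℤ) ^ (l - 1 - i) *
    ∑ k ∈ Finset.Icc 1 (p - 1),
      (x (n - i) (j - (p : ℤ) ^ (n - l) + (k : ℤ) * (p : ℤ) ^ (n - 1 - i)) -
        if l = n then 0 else
          x (n - i) (j % (p : ℤ) ^ (n - l - 1) - (p : ℤ) ^ (n - l - 1)
            + (k : ℤ) * (p : ℤ) ^ (n - 1 - i)))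

/-- The tuples `(∑_{j ∈ [0, φ(p^i)-1]} x_{i,j} ζ_{p^i}^j)_{i ∈ [0,n]}` whose integral coefficients
satisfy all ties. -/
def tieSet {K : Type*} [Field K] (p n : ℕ) (ζ : ℕ → K) : Set (CycloProd n ζ) :=
  {y | ∃ x : ℕ → ℤ → ℤ,
    (∀ i : Fin (n + 1), (y i : K) =
      ∑ j ∈ Finset.range (Nat.totient (p ^ (i : ℕ))), (x i j : K) * ζ i ^ j) ∧
    ∀ l ∈ Finset.Icc 1 n, ∀ j ∈ Finset.range (Nat.totient (p ^ (n - l))),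
      x (n - l) j ≡ tieSum p n x l j [ZMOD (p : ℤ) ^ l]}

open Classical in
/-- The operator `T_i^{m,s}` on finitely supported integer sequences: for `i ≥ m`,
`(T_i^{m,s} x)_j = χ_{[0,p^i-1]}(j) ∑_{k ∈ ℤ} x_{[j]_{p^{i-m}} - p^{i-m} + k p^{i+s}}`,
and `T_i^{m,s} x = 0` for `i < m`. -/
noncomputable def opT (p m s i : ℕ) (x : ℤ →₀ ℤ) : ℤ →₀ ℤ :=
  Finsupp.onFinset (Finset.Icc 0 ((p : ℤ) ^ i - 1))
    (fun j => if m ≤ i ∧ j ∈ Finset.Icc 0 ((p : ℤ) ^ i - 1) then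
      ∑ᶠ k : ℤ, x (j % (p : ℤ) ^ (i - m) - (p : ℤ) ^ (i - m) + k * (p : ℤ) ^ (i + s)) else 0)
    (fun _ hj => by
      by_contra h
      exact hj (if_neg fun h' => h h'.2))

/-- `x ∗ z = ∑_{j ∈ ℤ} x_j z^j`. -/
noncomputable def seqEval {K : Type*} [Field K] (x : ℤ →₀ ℤ) (z : K) : K :=
  x.sum fun j a => (a : K) * z ^ j

/-- The second description of the image, by means of the operators `T_i^{m,s}`. -/
def tieSetT {K : Type*} [Field K] (p n : ℕ) (ζ : ℕ → K) : Set (CycloProd n ζ) :=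
  {y | ∃ x : ℕ → (ℤ →₀ ℤ),
    (∀ i ≤ n, (x i).support ⊆ Finset.Icc 0 ((Nat.totient (p ^ i) : ℤ) - 1)) ∧
    (∀ i : Fin (n + 1), (y i : K) = seqEval (x i) (ζ i)) ∧
    ∀ l ∈ Finset.Icc 1 n, ∀ j : ℤ,
      x (n - l) j ≡ (∑ i ∈ Finset.range l, (p : ℤ) ^ (l - 1 - i) •
        (opT p 0 (l - 1 - i) (n - l) (x (n - i)) - opT p 1 (l - 1 - i) (n - l) (x (n - i)))) j
        [ZMOD (p : ℤ) ^ l]}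

/-- The elementary divisors of the linear map `f` between free modules of the same finite rank are
the `d a`, listed with multiplicity: `f` has diagonal matrix `diag(d a)` with respect to suitable
bases, and the diagonal entries form a chain with respect to divisibility. -/
def HasElementaryDivisors {R M N ι : Type*} [CommRing R] [AddCommGroup M] [AddCommGroup N]
    [Module R M] [Module R N] [Finite ι] (f : M →ₗ[R] N) (d : ι → R) : Prop :=
  (∀ a b : ι, d a ∣ d b ∨ d b ∣ d a) ∧
  ∃ (u : Module.Basis ι R M) (v : Module.Basis ι R N), ∀ a, f (u a) = d a • v a

/-! Write D_m(a) for the indicator of p^m ∣ a. The proof has three ingredients.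

The image satisfies the ties. The ties are additive, so it suffices to test ω(c^t) = (ζ_i^t)_i. For
m ≥ 1, the coordinate of ζ_m^t at j is D_m(j - t) - D_m([j]_{p^{m-1}} - p^{m-1} - t) (`powCoeff`);
for m = 0 only the first term is present. The inner sums over k are of the form D_m(b - t) - p
D_{m+1}(b - t) (`sum_powCoeff`), so the weights p^{l-1-i} make the sum over i telescope to D_{n-l}(b
- t) - p^l D_n(b - t). Modulo p^l, the two values of b in a tie recover the two terms of the
coordinate at level n - l.

The ties suffice. For N_{m,j} = c^j ∑_{s < p^{n-m}} c^{s p^m}, the image ω(N_{m,j}) is p^{n-m} times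
the tuple e_{m,j} with entries ζ_i^j for i ≤ m and 0 for i > m (`wedderburn_normElt`). If a tuple
satisfies the ties and vanishes above level k, the tie at level k reduces to divisibility of the
k-th coordinates by p^{n-k}. A combination of the ω(N_{k,j}) then clears the k-th entry, and the
difference again satisfies the ties. Descent on k finishes.

Elementary divisors. For m ≤ n and j < φ(p^m), the e_{m,j} form a basis of the product, by
triangularity, and the N_{m,j} form a basis of the group ring. In these bases ω is diagonal, with
entry p^{n-m} occurring φ(p^m) times. -/

open Polynomial in
theorem exists_coords {K : Type*} [Field K] [CharZero K] {m : ℕ} (hm : 0 < m) {z : K}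
    (hz : IsPrimitiveRoot z m) {y : K} (hy : y ∈ Algebra.adjoin ℤ ({z} : Set K)) :
    ∃ x : ℤ → ℤ, y = ∑ j ∈ Finset.range m.totient, (x j : K) * z ^ j := by
  rw [Algebra.adjoin_singleton_eq_range_aeval] at hy
  obtain ⟨f, rfl⟩ := hy
  have hmon := cyclotomic.monic m ℤ
  have h0 : aeval z (cyclotomic m ℤ) = 0 := by
    rw [aeval_def, ← eval_map, map_cyclotomic]
    exact hz.isRoot_cyclotomic hm
  have hdeg : (f %ₘ cyclotomic m ℤ).natDegree < m.totient := by
    rw [← natDegree_cyclotomic m ℤ]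
    refine natDegree_modByMonic_lt f hmon fun h => ?_
    have := natDegree_cyclotomic m ℤ
    rw [h, natDegree_one] at this
    exact (Nat.totient_pos.2 hm).ne this
  refine ⟨fun j => (f %ₘ cyclotomic m ℤ).coeff j.toNat, ?_⟩
  have := aeval_eq_sum_range' hdeg z
  simp only [Int.toNat_natCast, ← zsmul_eq_mul]
  rw [← this]
  -- The remainder modulo the cyclotomic polynomial has the same value at `z`, since `z` is a root
  -- of that polynomial.
  conv_lhs => rw [← modByMonic_add_div f (cyclotomic m ℤ)]
  simp [h0]

theorem coords_eq_zero {K : Type*} [Field K] [CharZero K] {m : ℕ} (hm : 0 < m) {z : K}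
    (hz : IsPrimitiveRoot z m) {x : ℤ → ℤ}
    (hx : ∑ j ∈ Finset.range m.totient, (x j : K) * z ^ j = 0) {j : ℕ}
    (hj : j < m.totient) : x j = 0 := by
  have hd : (minpoly ℚ z).natDegree = m.totient := by
    rw [← Polynomial.cyclotomic_eq_minpoly_rat hz hm, Polynomial.natDegree_cyclotomic]
  have h := Fintype.linearIndependent_iff.1 (linearIndependent_pow (K := ℚ) z)
    (fun i => (x (i : ℕ) : ℚ)) ?_ ⟨j, hd ▸ hj⟩
  · exact_mod_cast h
  · rw [Fin.sum_univ_eq_sum_range (fun i => (x (i : ℕ) : ℚ) • z ^ i), hd, ← hx]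
    refine Finset.sum_congr rfl fun i _ => ?_
    rw [Algebra.smul_def]
    simp

/-! ### Coordinates of powers of a root of unity, and their telescoping sums -/

theorem sum_range_mul_eq {M : Type*} [AddCommMonoid M] (f : ℕ → M) (a b : ℕ) :
    ∑ i ∈ Finset.range (a * b), f i =
      ∑ k ∈ Finset.range b, ∑ i ∈ Finset.range a, f (a * k + i) := by
  induction b with
  | zero => simp
  | succ b ih => rw [mul_add, mul_one, Finset.sum_range_add, ih, Finset.sum_range_succ]

/-- The indicator of divisibility. -/
def dvdInd (q a : ℤ) : ℤ := if q ∣ a then 1 else 0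

theorem dvdInd_congr {q a b : ℤ} (h : q ∣ a - b) : dvdInd q a = dvdInd q b := by
  simp only [dvdInd, dvd_iff_dvd_of_dvd_sub h]

/-- If a = qb, divisibility of a + kq by qp means k ≡ -b mod p, which has exactly one solution in
[0, p - 1]; if q does not divide a, no term contributes. -/
theorem sum_dvdInd {q : ℤ} (hq : 0 < q) {p : ℕ} (hp : 0 < p) (a : ℤ) :
    ∑ k ∈ Finset.range p, dvdInd (q * p) (a + k * q) = dvdInd q a := by
  by_cases h : q ∣ a
  · obtain ⟨b, rfl⟩ := h
    have hp' : (0 : ℤ) < p := by exact_mod_cast hp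
    have h0 := Int.emod_nonneg (-b) hp'.ne'
    have h1 := Int.emod_lt_of_pos (-b) hp'
    have key : ∀ k : ℕ, q * p ∣ q * b + k * q ↔ (p : ℤ) ∣ b + k := fun k => by
      rw [mul_comm (k : ℤ) q, ← mul_add, mul_dvd_mul_iff_left hq.ne']
    have hk : (p : ℤ) ∣ b + (-b) % p := by
      have := Int.emod_add_mul_ediv (-b) p
      exact ⟨-((-b) / p), by linarith⟩
    rw [Finset.sum_eq_single ((-b) % p).toNat]
    · have hk' := (key ((-b) % p).toNat).2 (by rwa [Int.toNat_of_nonneg h0])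
      rw [dvdInd, if_pos hk', dvdInd, if_pos (dvd_mul_right q b)]
    · intro k hk' hne
      rw [dvdInd, if_neg]
      rw [key]
      intro hd
      apply hne
      have hd2 : (p : ℤ) ∣ k - (-b) % p := by
        have := dvd_sub hd hk
        rwa [add_sub_add_left_eq_sub] at this
      have := Int.eq_zero_of_abs_lt_dvd hd2 (by
        rw [abs_lt]
        have := Finset.mem_range.1 hk'
        constructor <;> omega)
      omega
    · intro hn
      exact absurd (Finset.mem_range.2 (by omega)) hn
  · rw [dvdInd, if_neg h]
    refine Finset.sum_eq_zero fun k _ => ?_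
    rw [dvdInd, if_neg]
    intro h'
    exact h ((dvd_add_left (Dvd.intro_left _ rfl)).1 ((dvd_mul_right q p).trans h'))

/-- The coefficients of `z ^ t` in the basis `z ^ j`, `j < φ(p ^ m)`, of `ℤ[z]`, where `z` is a
primitive `p ^ m`-th root of unity. -/
def powCoeff (p t m : ℕ) (j : ℤ) : ℤ :=
  dvdInd ((p : ℤ) ^ m) (j - t) -
    if m = 0 then 0 else dvdInd ((p : ℤ) ^ m) (j % (p : ℤ) ^ (m - 1) - (p : ℤ) ^ (m - 1) - t)

theorem pow_eq_sum_powCoeff {K : Type*} [Field K] {p m : ℕ} (hp : p.Prime) {z : K}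
    (hz : IsPrimitiveRoot z (p ^ m)) (t : ℕ) :
    z ^ t = ∑ j ∈ Finset.range (p ^ m).totient, (powCoeff p t m j : K) * z ^ j := by
  rcases m with _ | m
  · have : z = 1 := by simpa using hz
    simp [this, powCoeff, dvdInd]
  have hsplit : p ^ m * (p - 1) + p ^ m = p ^ m * p := by
    rw [← mul_add_one, Nat.sub_add_cancel hp.one_le]
  have hq : 0 < p ^ m := pow_pos hp.pos m
  have hqp : 0 < p ^ m * p := mul_pos hq hp.pos
  -- For j = p^m (p - 1) + a with a < p^m, the number (j mod p^m) - p^m equals j - p^(m+1), so the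
  -- two indicators cancel. The coefficients vanish on the last block, and the sum extends to a full
  -- period.
  have hfull : ∑ j ∈ Finset.range (p ^ (m + 1)).totient, (powCoeff p t (m + 1) j : K) * z ^ j =
      ∑ j ∈ Finset.range (p ^ m * p), (powCoeff p t (m + 1) j : K) * z ^ j := by
    rw [Nat.totient_prime_pow_succ hp, ← hsplit, Finset.sum_range_add, left_eq_add]
    refine Finset.sum_eq_zero fun a ha => ?_
    have ha' : (a : ℤ) < (p : ℤ) ^ m := by exact_mod_cast Finset.mem_range.1 ha
    have hmod : ((p ^ m * (p - 1) + a : ℕ) : ℤ) % (p : ℤ) ^ m = a := by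
      push_cast
      rw [Int.mul_add_emod_self_left]
      exact Int.emod_eq_of_lt (by positivity) ha'
    have hd : powCoeff p t (m + 1) ((p ^ m * (p - 1) + a : ℕ) : ℤ) = 0 := by
      rw [powCoeff, if_neg (Nat.succ_ne_zero m), Nat.add_sub_cancel, hmod, sub_eq_zero]
      apply dvdInd_congr
      have hs : ((p ^ m * (p - 1) : ℕ) : ℤ) + (p : ℤ) ^ m = (p : ℤ) ^ m * p := by
        exact_mod_cast hsplit
      refine ⟨1, ?_⟩
      rw [Nat.cast_add, pow_succ]
      linarith
    rw [hd]
    simp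
  have h1 : ∑ j ∈ Finset.range (p ^ m * p),
      (dvdInd ((p : ℤ) ^ (m + 1)) ((j : ℤ) - t) : K) * z ^ j = z ^ t := by
    rw [Finset.sum_eq_single (t % (p ^ m * p))]
    · rw [dvdInd, if_pos, ← pow_succ, Int.cast_one, one_mul, eq_comm,
        ← pow_mod_orderOf, ← hz.eq_orderOf]
      have := Nat.mod_add_div t (p ^ m * p)
      refine ⟨-((t / (p ^ m * p) : ℕ) : ℤ), ?_⟩
      rw [pow_succ]
      zify at this
      push_cast
      linarith
    · intro j hj hne
      rw [dvdInd, if_neg]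
      · simp
      · intro h
        apply hne
        have h' : (t : ℤ) ≡ j [ZMOD ((p ^ m * p : ℕ) : ℤ)] := by
          rw [Int.modEq_iff_dvd]
          exact_mod_cast (pow_succ (p : ℤ) m) ▸ h
        have h2 := (Int.natCast_modEq_iff.1 h')
        rw [Nat.ModEq, Nat.mod_eq_of_lt (Finset.mem_range.1 hj)] at h2
        exact h2.symm
    · intro h
      exact absurd (Finset.mem_range.2 (Nat.mod_lt _ hqp)) h
  -- The second indicator depends only on j mod p^m, so the sum over a full period factors through
  -- the sum of all powers of the primitive p-th root of unity z^(p^m), which is zero.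
  have h2 : ∑ j ∈ Finset.range (p ^ m * p),
      (dvdInd ((p : ℤ) ^ (m + 1)) ((j : ℤ) % (p : ℤ) ^ m - (p : ℤ) ^ m - t) : K) * z ^ j = 0 := by
    rw [sum_range_mul_eq]
    have hg : ∑ k ∈ Finset.range p, (z ^ p ^ m) ^ k = 0 :=
      (hz.pow (pow_pos hp.pos _) (pow_succ p m)).geom_sum_eq_zero hp.one_lt
    calc _ = ∑ k ∈ Finset.range p, (z ^ p ^ m) ^ k * ∑ a ∈ Finset.range (p ^ m),
          (dvdInd ((p : ℤ) ^ (m + 1)) ((a : ℤ) - (p : ℤ) ^ m - t) : K) * z ^ a := by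
          refine Finset.sum_congr rfl fun k _ => ?_
          rw [Finset.mul_sum]
          refine Finset.sum_congr rfl fun a ha => ?_
          have ha' : (a : ℤ) < (p : ℤ) ^ m := by exact_mod_cast Finset.mem_range.1 ha
          have : ((p ^ m * k + a : ℕ) : ℤ) % (p : ℤ) ^ m = a := by
            push_cast
            rw [Int.mul_add_emod_self_left]
            exact Int.emod_eq_of_lt (by positivity) ha'
          rw [this, pow_add z, pow_mul z]
          ring
      _ = 0 := by rw [← Finset.sum_mul, hg, zero_mul]
  rw [hfull]
  have : ∀ j : ℕ, (powCoeff p t (m + 1) j : K) * z ^ j =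
      (dvdInd ((p : ℤ) ^ (m + 1)) ((j : ℤ) - t) : K) * z ^ j -
      (dvdInd ((p : ℤ) ^ (m + 1)) ((j : ℤ) % (p : ℤ) ^ m - (p : ℤ) ^ m - t) : K) * z ^ j :=
    fun j => by
      rw [powCoeff, if_neg (Nat.succ_ne_zero m), Nat.add_sub_cancel, Int.cast_sub, sub_mul]
  simp only [this]
  rw [Finset.sum_sub_distrib, h1, h2, sub_zero]

/-- Over k ∈ [0, p - 1] the first indicators would add up to D_m(b - t); the absent k = 0 costs one
D_{m+1}(b - t). The bounds on `b` make b + p^m the residue modulo p^m, so the second indicator is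
D_{m+1}(b - t) for each of the p - 1 values of k. Altogether p copies are subtracted. -/
theorem sum_powCoeff {p : ℕ} (hp : 0 < p) (t m : ℕ) {b : ℤ} (hb : b < 0) (hb' : -(p : ℤ) ^ m ≤ b) :
    ∑ k ∈ Finset.Icc 1 (p - 1), powCoeff p t (m + 1) (b + (k : ℤ) * (p : ℤ) ^ m) =
      dvdInd ((p : ℤ) ^ m) (b - t) - p * dvdInd ((p : ℤ) ^ (m + 1)) (b - t) := by
  have hterm : ∀ k : ℕ, powCoeff p t (m + 1) (b + (k : ℤ) * (p : ℤ) ^ m) =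
      dvdInd ((p : ℤ) ^ m * p) (b - t + k * (p : ℤ) ^ m) - dvdInd ((p : ℤ) ^ (m + 1)) (b - t) := by
    intro k
    have : (b + (k : ℤ) * (p : ℤ) ^ m) % (p : ℤ) ^ m = b + (p : ℤ) ^ m := by
      rw [Int.add_mul_emod_self_right, ← Int.add_emod_right]
      exact Int.emod_eq_of_lt (by linarith) (by linarith)
    rw [powCoeff, if_neg (Nat.succ_ne_zero m), Nat.add_sub_cancel, this, ← pow_succ]
    congr 2 <;> ring
  have hr : Finset.range p = insert 0 (Finset.Icc 1 (p - 1)) := by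
    ext k
    simp only [Finset.mem_range, Finset.mem_insert, Finset.mem_Icc]
    omega
  have hs := sum_dvdInd (pow_pos (Int.natCast_pos.2 hp) m) hp (b - t)
  rw [hr, Finset.sum_insert (by simp)] at hs
  simp only [hterm]
  rw [Finset.sum_sub_distrib, ← hs, Finset.sum_const, Nat.card_Icc, Nat.add_sub_cancel, pow_succ]
  have : ((p - 1 : ℕ) : ℤ) = p - 1 := by omega
  rw [nsmul_eq_mul, this]
  simp
  ring

/-- The sum over `k` and `i` of one of the two summands of `tieSum`, with `b` the residue. -/
theorem telescope_powCoeff {p n : ℕ} (hp : 0 < p) (t : ℕ) {l : ℕ} (hl : l ≤ n) {b : ℤ} (hb : b < 0)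
    (hb' : -(p : ℤ) ^ (n - l) ≤ b) :
    ∑ i ∈ Finset.range l, (p : ℤ) ^ (l - 1 - i) * ∑ k ∈ Finset.Icc 1 (p - 1),
      powCoeff p t (n - i) (b + (k : ℤ) * (p : ℤ) ^ (n - 1 - i)) =
    dvdInd ((p : ℤ) ^ (n - l)) (b - t) - (p : ℤ) ^ l * dvdInd ((p : ℤ) ^ n) (b - t) := by
  -- By `sum_powCoeff` the i-th summand is f(i + 1) - f(i) with f(i) = p^(l-i) D_{n-i}(b - t).
  have h := Finset.sum_range_sub
    (fun i => (p : ℤ) ^ (l - i) * dvdInd ((p : ℤ) ^ (n - i)) (b - t)) l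
  simp only [Nat.sub_self, pow_zero, one_mul, Nat.sub_zero] at h
  rw [← h]
  refine Finset.sum_congr rfl fun i hi => ?_
  have hi := Finset.mem_range.1 hi
  have hle : (p : ℤ) ^ (n - l) ≤ (p : ℤ) ^ (n - 1 - i) :=
    pow_le_pow_right₀ (by exact_mod_cast hp) (by omega)
  have e1 : n - i = n - 1 - i + 1 := by omega
  have e2 : l - i = l - 1 - i + 1 := by omega
  have e3 : l - (i + 1) = l - 1 - i := by omega
  have e4 : n - (i + 1) = n - 1 - i := by omega
  rw [e3, e4, e1, e2, sum_powCoeff hp t _ hb (by linarith), pow_succ]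
  ring

theorem tieSum_eq {p n : ℕ} (x : ℕ → ℤ → ℤ) (l : ℕ) (j : ℤ) :
    tieSum p n x l j =
      (∑ i ∈ Finset.range l, (p : ℤ) ^ (l - 1 - i) * ∑ k ∈ Finset.Icc 1 (p - 1),
        x (n - i) (j - (p : ℤ) ^ (n - l) + (k : ℤ) * (p : ℤ) ^ (n - 1 - i))) -
      if l = n then 0 else
        ∑ i ∈ Finset.range l, (p : ℤ) ^ (l - 1 - i) * ∑ k ∈ Finset.Icc 1 (p - 1),
          x (n - i) (j % (p : ℤ) ^ (n - l - 1) - (p : ℤ) ^ (n - l - 1)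
            + (k : ℤ) * (p : ℤ) ^ (n - 1 - i)) := by
  unfold tieSum
  split_ifs with h
  · simp
  · simp only [Finset.sum_sub_distrib, mul_sub]

/-- The telescoped sums at b = j - p^(n-l) and, for l < n, at b = [j]_{p^(n-l-1)} - p^(n-l-1) agree
modulo p^l with the indicators in `powCoeff`; in the first, the shift by p^(n-l) does not affect
divisibility by p^(n-l). -/
theorem powCoeff_tie {p n : ℕ} (hp : 0 < p) (t : ℕ) {l : ℕ} (hl : l ≤ n) {j : ℕ}
    (hj : j < p ^ (n - l)) :
    powCoeff p t (n - l) j ≡ tieSum p n (powCoeff p t) l j [ZMOD (p : ℤ) ^ l] := by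
  have hpz : (0 : ℤ) < p := by exact_mod_cast hp
  have hj' : (j : ℤ) < (p : ℤ) ^ (n - l) := by exact_mod_cast hj
  have hc : dvdInd ((p : ℤ) ^ (n - l)) (j - (p : ℤ) ^ (n - l) - t) =
      dvdInd ((p : ℤ) ^ (n - l)) (j - t) := dvdInd_congr ⟨-1, by ring⟩
  rw [tieSum_eq, telescope_powCoeff hp t hl (by linarith) (by linarith), hc, powCoeff]
  by_cases h : l = n
  · subst h
    rw [if_pos (by omega), if_pos rfl, Int.modEq_iff_dvd]
    exact ⟨-dvdInd ((p : ℤ) ^ l) (j - (p : ℤ) ^ (l - l) - t), by ring⟩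
  · have hq : (0 : ℤ) < (p : ℤ) ^ (n - l - 1) := pow_pos hpz _
    have h0 := Int.emod_nonneg (j : ℤ) hq.ne'
    have h1 := Int.emod_lt_of_pos (j : ℤ) hq
    have hle : (p : ℤ) ^ (n - l - 1) ≤ (p : ℤ) ^ (n - l) :=
      pow_le_pow_right₀ (by exact_mod_cast hp) (by omega)
    rw [if_neg (by omega), if_neg h, telescope_powCoeff hp t hl (by linarith) (by linarith),
      Int.modEq_iff_dvd]
    exact ⟨dvdInd ((p : ℤ) ^ n) (j % (p : ℤ) ^ (n - l - 1) - (p : ℤ) ^ (n - l - 1) - t)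
      - dvdInd ((p : ℤ) ^ n) (j - (p : ℤ) ^ (n - l) - t), by ring⟩

/-! ### Triangularity and additivity of the ties -/

theorem exists_index {p : ℕ} (hp : p.Prime) (m : ℕ) {b : ℤ} (hb : b < 0) (hb' : -(p : ℤ) ^ m ≤ b)
    {k : ℕ} (hk : k ∈ Finset.Icc 1 (p - 1)) :
    ∃ j < (p ^ (m + 1)).totient, b + (k : ℤ) * (p : ℤ) ^ m = (j : ℕ) := by
  obtain ⟨h1, h2⟩ := Finset.mem_Icc.1 hk
  have hq : (0 : ℤ) < (p : ℤ) ^ m := pow_pos (by exact_mod_cast hp.pos) m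
  have h1' : (p : ℤ) ^ m ≤ k * (p : ℤ) ^ m := le_mul_of_one_le_left hq.le (by exact_mod_cast h1)
  have h2' : (k : ℤ) * (p : ℤ) ^ m ≤ ((p - 1 : ℕ) : ℤ) * (p : ℤ) ^ m :=
    mul_le_mul_of_nonneg_right (by exact_mod_cast h2) hq.le
  refine ⟨(b + (k : ℤ) * (p : ℤ) ^ m).toNat, ?_, (Int.toNat_of_nonneg (by linarith)).symm⟩
  rw [Nat.totient_prime_pow_succ hp, ← Nat.cast_lt (α := ℤ), Int.toNat_of_nonneg (by linarith)]
  push_cast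
  linarith

theorem tieSum_congr {p n : ℕ} (hp : p.Prime) {l : ℕ} (hl : l ≤ n) {j : ℕ}
    (hj : j < p ^ (n - l)) {x x' : ℕ → ℤ → ℤ}
    (h : ∀ m ∈ Finset.Icc (n - l + 1) n, ∀ j' ∈ Finset.range (Nat.totient (p ^ m)),
      x m j' = x' m j') :
    tieSum p n x l j = tieSum p n x' l j := by
  have hpz : (1 : ℤ) ≤ p := by exact_mod_cast hp.one_le
  have hj' : (j : ℤ) < (p : ℤ) ^ (n - l) := by exact_mod_cast hj
  -- Both kinds of index in a tie are b + k p^(n-1-i) with -p^(n-l) ≤ b < 0 and 1 ≤ k ≤ p - 1, hence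
  -- lie in [0, φ(p^(n-i)) - 1].
  have key : ∀ i < l, ∀ b : ℤ, b < 0 → -(p : ℤ) ^ (n - l) ≤ b → ∀ k ∈ Finset.Icc 1 (p - 1),
      x (n - i) (b + (k : ℤ) * (p : ℤ) ^ (n - 1 - i)) =
        x' (n - i) (b + (k : ℤ) * (p : ℤ) ^ (n - 1 - i)) := by
    intro i hi b hb hb' k hk
    have hle : (p : ℤ) ^ (n - l) ≤ (p : ℤ) ^ (n - 1 - i) := pow_le_pow_right₀ hpz (by omega)
    obtain ⟨j', hj', e⟩ := exists_index hp (n - 1 - i) hb (by linarith) hk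
    rw [e]
    refine h _ (Finset.mem_Icc.2 (by omega)) _ (Finset.mem_range.2 ?_)
    rwa [show n - i = n - 1 - i + 1 by omega]
  refine Finset.sum_congr rfl fun i hi => ?_
  congr 1
  refine Finset.sum_congr rfl fun k hk => ?_
  rw [key i (Finset.mem_range.1 hi) _ (by linarith) (by linarith) k hk]
  split_ifs with hln
  · rfl
  · have hq : (0 : ℤ) < (p : ℤ) ^ (n - l - 1) := pow_pos (by linarith) _
    have h0 := Int.emod_nonneg (j : ℤ) hq.ne'
    have h1 := Int.emod_lt_of_pos (j : ℤ) hq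
    have hle : (p : ℤ) ^ (n - l - 1) ≤ (p : ℤ) ^ (n - l) := pow_le_pow_right₀ hpz (by omega)
    rw [key i (Finset.mem_range.1 hi) _ (by linarith) (by linarith) k hk]

theorem tieSum_zero (p n l : ℕ) (j : ℤ) : tieSum p n 0 l j = 0 := by simp [tieSum]

theorem tieSum_add {p n : ℕ} (x x' : ℕ → ℤ → ℤ) (l : ℕ) (j : ℤ) :
    tieSum p n (x + x') l j = tieSum p n x l j + tieSum p n x' l j := by
  unfold tieSum
  split_ifs <;>
  simp only [← Finset.sum_add_distrib, ← mul_add, Pi.add_apply] <;>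
  refine Finset.sum_congr rfl fun i _ => ?_ <;>
  congr 1 <;>
  refine Finset.sum_congr rfl fun k _ => ?_ <;>
  ring

theorem tieSum_neg {p n : ℕ} (x : ℕ → ℤ → ℤ) (l : ℕ) (j : ℤ) :
    tieSum p n (-x) l j = -tieSum p n x l j := by
  rw [eq_neg_iff_add_eq_zero, ← tieSum_add, neg_add_cancel, tieSum_zero]

/-! ### Norm elements, and the ties on the image -/

section Ties

variable {K : Type*} [Field K]

/-- The tuples satisfying the ties form a subgroup. -/
def tieSubgroup (p n : ℕ) (ζ : ℕ → K) : AddSubgroup (CycloProd n ζ) where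
  carrier := tieSet p n ζ
  zero_mem' := ⟨0, by simp, fun l _ j _ => by simp [tieSum_zero]⟩
  add_mem' := by
    rintro y y' ⟨x, hx, h⟩ ⟨x', hx', h'⟩
    refine ⟨x + x', fun i => ?_, fun l hl j hj => ?_⟩
    · simp [hx, hx', add_mul, Finset.sum_add_distrib]
    · rw [tieSum_add]
      exact (h l hl j hj).add (h' l hl j hj)
  neg_mem' := by
    rintro y ⟨x, hx, h⟩
    refine ⟨-x, fun i => ?_, fun l hl j hj => ?_⟩
    · simp [hx]
    · rw [tieSum_neg]
      exact (h l hl j hj).neg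

/-- The tuple with `i`-th entry `ζ i ^ j` for `i ≤ m` and `0` for `i > m`. -/
def truncPow (n : ℕ) (ζ : ℕ → K) (m j : ℕ) : CycloProd n ζ :=
  fun i => if (i : ℕ) ≤ m then zetaTuple n ζ i ^ j else 0

theorem coe_truncPow (n : ℕ) (ζ : ℕ → K) (m j : ℕ) (i : Fin (n + 1)) :
    (truncPow n ζ m j i : K) = if (i : ℕ) ≤ m then ζ i ^ j else 0 := by
  unfold truncPow zetaTuple
  split_ifs <;> simp

/-- The element `c ^ j * ∑ c ^ (s p ^ m)` of the group ring, the sum being over `s < p ^ (n - m)`. -/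
noncomputable def normElt {G : Type*} [Group G] (p n : ℕ) (c : G) (m j : ℕ) : MonoidAlgebra ℤ G :=
  ∑ s ∈ Finset.range (p ^ (n - m)), MonoidAlgebra.of ℤ G (c ^ (j + p ^ m * s))

theorem exists_pow_eq {p n : ℕ} (hp : p.Prime) {G : Type*} [Group G] {c : G}
    (hc : ∀ g : G, g ∈ Subgroup.zpowers c) (hG : Nat.card G = p ^ n) (g : G) : ∃ t : ℕ, c ^ t = g := by
  have : Finite G := Nat.finite_of_card_ne_zero (hG ▸ (pow_pos hp.pos n).ne')
  exact mem_powers_iff_mem_zpowers.2 (hc g)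

section

variable {p n : ℕ} (hp : p.Prime) {ζ : ℕ → K}
  (hζ : ∀ i ≤ n, IsPrimitiveRoot (ζ i) (p ^ i)) {G : Type*} [Group G] {c : G}
  (hc : ∀ g : G, g ∈ Subgroup.zpowers c) (hG : Nat.card G = p ^ n)

theorem wedderburn_pow (t : ℕ) (i : Fin (n + 1)) :
    (wedderburn hp hζ hc hG (MonoidAlgebra.of ℤ G (c ^ t)) i : K) = ζ i ^ t := by
  rw [map_pow, map_pow, wedderburn_gen]
  simp [zetaTuple]

/-- For i ≤ m the element ζ_i^(p^m) is 1 and all p^(n-m) summands agree; for i > m it is a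
nontrivial p^(n-m)-th root of unity, so the geometric sum vanishes. -/
theorem wedderburn_normElt {m : ℕ} (hm : m ≤ n) (j : ℕ) :
    wedderburn hp hζ hc hG (normElt p n c m j) = (p : ℤ) ^ (n - m) • truncPow n ζ m j := by
  funext i
  apply Subtype.ext
  have hi : (i : ℕ) ≤ n := Nat.lt_succ_iff.mp i.2
  rw [normElt, map_sum, Finset.sum_apply, AddSubmonoidClass.coe_finsetSum]
  simp only [wedderburn_pow]
  simp only [pow_add, pow_mul, ← Finset.mul_sum]
  rw [Pi.smul_apply, SetLike.val_smul, coe_truncPow]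
  split_ifs with h
  · have : ζ i ^ p ^ m = 1 := ((hζ i hi).pow_eq_one_iff_dvd _).2 (pow_dvd_pow p h)
    simp [this, mul_comm]
  · have h1 : ζ i ^ p ^ m ≠ 1 := fun h' => h
      ((Nat.pow_dvd_pow_iff_le_right hp.one_lt).1 (((hζ i hi).pow_eq_one_iff_dvd _).1 h'))
    have h2 : (ζ i ^ p ^ m) ^ p ^ (n - m) = 1 := by
      rw [← pow_mul, ← pow_add, Nat.add_sub_cancel' hm]
      exact ((hζ i hi).pow_eq_one_iff_dvd _).2 (pow_dvd_pow p hi)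
    have h3 := geom_sum_mul (ζ i ^ p ^ m) (p ^ (n - m))
    rw [h2, sub_self, mul_eq_zero, or_iff_left (sub_ne_zero.2 h1)] at h3
    rw [h3, mul_zero, smul_zero]

theorem range_le_tieSet : Set.range (wedderburn hp hζ hc hG) ⊆ tieSet p n ζ := by
  rintro _ ⟨g, rfl⟩
  change wedderburn hp hζ hc hG g ∈ tieSubgroup p n ζ
  induction g using MonoidAlgebra.induction_on with
  | of g =>
    obtain ⟨t, rfl⟩ := exists_pow_eq hp hc hG g
    refine ⟨powCoeff p t, fun i => ?_, fun l hl j hj => ?_⟩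
    · rw [wedderburn_pow]
      exact pow_eq_sum_powCoeff hp (hζ i (Nat.lt_succ_iff.mp i.2)) t
    · exact powCoeff_tie hp.pos t (Finset.mem_Icc.1 hl).2
        ((Finset.mem_range.1 hj).trans_le (Nat.totient_le _))
  | add x y hx hy => rw [map_add]; exact add_mem hx hy
  | smul r x hx => rw [map_smul]; exact zsmul_mem hx r

end

/-- Subtracting the leading component of a tuple. -/
theorem sub_truncPow_eq_zero {p n : ℕ} {ζ : ℕ → K} {k : Fin (n + 1)} {y : CycloProd n ζ} (hy : ∀ i > k, y i = 0)
    {x : ℤ → ℤ} (hx : (y k : K) = ∑ j ∈ Finset.range (p ^ (k : ℕ)).totient, (x j : K) * ζ k ^ j)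
    {i : Fin (n + 1)} (hi : k ≤ i) :
    (y - ∑ j ∈ Finset.range (p ^ (k : ℕ)).totient, x j • truncPow n ζ k j) i = 0 := by
  apply Subtype.ext
  rw [Pi.sub_apply, Finset.sum_apply, AddSubgroupClass.coe_sub, AddSubmonoidClass.coe_finsetSum]
  rcases hi.eq_or_lt with rfl | h
  · rw [hx]
    simp [coe_truncPow]
  · have : ¬ (i : ℕ) ≤ k := not_le.2 h
    simp [hy i h, coe_truncPow, this]

end Ties

/-! ### Descent: the ties imply membership in the image -/

theorem exists_coords_component {K : Type*} [Field K] [CharZero K] {p n : ℕ} (hp : p.Prime)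
    {ζ : ℕ → K} (hζ : ∀ i ≤ n, IsPrimitiveRoot (ζ i) (p ^ i)) (y : CycloProd n ζ)
    (i : Fin (n + 1)) :
    ∃ x : ℤ → ℤ, (y i : K) = ∑ j ∈ Finset.range (p ^ (i : ℕ)).totient, (x j : K) * ζ i ^ j :=
  exists_coords (pow_pos hp.pos _) (hζ i (Nat.lt_succ_iff.mp i.2)) (y i).2

/-- A subgroup of the product contains `y` as soon as, for tuples with vanishing entries above `k`
that satisfy `P`, one can subtract an element of the subgroup clearing the `k`-th entry. -/
theorem mem_of_clear {K : Type*} [Field K] {n : ℕ} {ζ : ℕ → K} (P : CycloProd n ζ → Prop)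
    (S : AddSubgroup (CycloProd n ζ))
    (h : ∀ (k : Fin (n + 1)) (y : CycloProd n ζ), P y → (∀ i > k, y i = 0) →
      ∃ w ∈ S, P (y - w) ∧ ∀ i ≥ k, (y - w) i = 0)
    {y : CycloProd n ζ} (hy : P y) : y ∈ S := by
  have main : ∀ k ≤ n + 1, ∀ y : CycloProd n ζ, P y →
      (∀ i : Fin (n + 1), k ≤ (i : ℕ) → y i = 0) → y ∈ S := by
    intro k
    induction k with
    | zero =>
      intro _ y _ h0
      have : y = 0 := funext fun i => h0 i (Nat.zero_le _)
      exact this ▸ zero_mem S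
    | succ k ih =>
      intro hk y hy h0
      obtain ⟨w, hw, hP, hz⟩ := h ⟨k, hk⟩ y hy fun i hi => h0 i hi
      rw [← sub_add_cancel y w]
      exact add_mem (ih (by omega) _ hP fun i hi => hz i hi) hw
  exact main (n + 1) le_rfl y hy fun i hi => absurd i.2 (by omega)

theorem tieSet_le_range {K : Type*} [Field K] [CharZero K] {p n : ℕ} (hp : p.Prime) {ζ : ℕ → K}
    (hζ : ∀ i ≤ n, IsPrimitiveRoot (ζ i) (p ^ i)) {G : Type*} [Group G] {c : G}
    (hc : ∀ g : G, g ∈ Subgroup.zpowers c) (hG : Nat.card G = p ^ n) :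
    tieSet p n ζ ⊆ Set.range (wedderburn hp hζ hc hG) := by
  intro y hy
  suffices y ∈ (wedderburn hp hζ hc hG).toLinearMap.toAddMonoidHom.range from this
  refine mem_of_clear (· ∈ tieSubgroup p n ζ) _ ?_ hy
  rintro k y hy h0
  obtain ⟨x, hx, htie⟩ := hy
  have hk : (k : ℕ) ≤ n := Nat.lt_succ_iff.mp k.2
  -- Uniqueness of coordinates turns vanishing entries above k into vanishing coefficients, which
  -- are the only ones the tie at level k involves.
  have hx0 : ∀ m ∈ Finset.Icc ((k : ℕ) + 1) n, ∀ j ∈ Finset.range (p ^ m).totient, x m j = 0 := by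
    intro m hm j hj
    obtain ⟨h1, h2⟩ := Finset.mem_Icc.1 hm
    have hm0 := h0 ⟨m, by omega⟩ (show (k : ℕ) < m from h1)
    refine coords_eq_zero (pow_pos hp.pos m) (hζ m h2) (x := x m) ?_ (Finset.mem_range.1 hj)
    rw [← hx ⟨m, by omega⟩, hm0]
    rfl
  have hdvd : ∀ j ∈ Finset.range (p ^ (k : ℕ)).totient, (p : ℤ) ^ (n - k) ∣ x k j := by
    intro j hj
    -- At the top level k = n there is no tie, and the required divisor is p^0 = 1.
    rcases hk.eq_or_lt with hkn | hkn
    · simp [hkn]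
    have ht := htie (n - k) (Finset.mem_Icc.2 (by omega)) j
      (by rwa [Nat.sub_sub_self hk])
    have hz : tieSum p n x (n - k) j = 0 := by
      rw [← tieSum_zero p n (n - k) j]
      apply tieSum_congr hp (Nat.sub_le _ _)
      · rw [Nat.sub_sub_self hk]
        exact (Finset.mem_range.1 hj).trans_le (Nat.totient_le _)
      · rw [Nat.sub_sub_self hk]
        exact hx0
    rw [hz, Nat.sub_sub_self hk] at ht
    exact Int.modEq_zero_iff_dvd.1 ht
  let g : MonoidAlgebra ℤ G := ∑ j ∈ Finset.range (p ^ (k : ℕ)).totient,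
    (x k j / (p : ℤ) ^ (n - k)) • normElt p n c k j
  have hg : wedderburn hp hζ hc hG g =
      ∑ j ∈ Finset.range (p ^ (k : ℕ)).totient, x k j • truncPow n ζ k j := by
    rw [map_sum]
    refine Finset.sum_congr rfl fun j hj => ?_
    rw [map_smul, wedderburn_normElt hp hζ hc hG hk, smul_smul, Int.ediv_mul_cancel (hdvd j hj)]
  refine ⟨_, ⟨g, rfl⟩, sub_mem ⟨x, hx, htie⟩ (range_le_tieSet hp hζ hc hG ⟨g, rfl⟩), ?_⟩
  intro i hi
  change (y - wedderburn hp hζ hc hG g) i = 0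
  rw [hg]
  exact sub_truncPow_eq_zero h0 (hx k) hi

theorem range_eq_tieSet {K : Type*} [Field K] [CharZero K] {p n : ℕ} (hp : p.Prime) {ζ : ℕ → K}
    (hζ : ∀ i ≤ n, IsPrimitiveRoot (ζ i) (p ^ i)) {G : Type*} [Group G] {c : G}
    (hc : ∀ g : G, g ∈ Subgroup.zpowers c) (hG : Nat.card G = p ^ n) :
    Set.range (wedderburn hp hζ hc hG) = tieSet p n ζ :=
  (range_le_tieSet hp hζ hc hG).antisymm (tieSet_le_range hp hζ hc hG)

/-! ### Bases that diagonalise ω -/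

section ElementaryDivisors

variable {K : Type*} [Field K] [CharZero K] {p n : ℕ} {ζ : ℕ → K}

theorem span_truncPow (hp : p.Prime) (hζ : ∀ i ≤ n, IsPrimitiveRoot (ζ i) (p ^ i)) :
    ⊤ ≤ Submodule.span ℤ (Set.range
      fun a : (i : Fin (n + 1)) × Fin (Nat.totient (p ^ (n - (i : ℕ)))) =>
        truncPow n ζ (n - a.1) a.2) := by
  intro y _
  rw [← Submodule.mem_toAddSubgroup]
  refine mem_of_clear (fun _ => True) _ ?_ trivial
  intro k y _ h0
  obtain ⟨x, hx⟩ := exists_coords_component hp hζ y k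
  refine ⟨_, ?_, trivial, fun i hi => sub_truncPow_eq_zero h0 hx hi⟩
  rw [Submodule.mem_toAddSubgroup]
  refine Submodule.sum_mem _ fun j hj => Submodule.smul_mem _ _ (Submodule.subset_span ?_)
  have hk : n - (n - (k : ℕ)) = k := Nat.sub_sub_self (Nat.lt_succ_iff.mp k.2)
  refine ⟨⟨⟨n - k, by omega⟩, ⟨j, ?_⟩⟩, ?_⟩
  · simpa only [hk] using Finset.mem_range.1 hj
  · simp only [hk]

theorem linearIndependent_truncPow (hp : p.Prime)
    (hζ : ∀ i ≤ n, IsPrimitiveRoot (ζ i) (p ^ i)) :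
    LinearIndependent ℤ
      fun a : (i : Fin (n + 1)) × Fin (Nat.totient (p ^ (n - (i : ℕ)))) =>
        truncPow n ζ (n - a.1) a.2 := by
  rw [Fintype.linearIndependent_iff]
  intro z hz
  suffices ∀ (l : ℕ) (hl : l < n + 1) (j : Fin (Nat.totient (p ^ (n - l)))), z ⟨⟨l, hl⟩, j⟩ = 0 from
    fun ⟨⟨l, hl⟩, j⟩ => this l hl j
  intro l
  induction l using Nat.strong_induction_on with
  | _ l ih =>
    intro hl j
    -- The entry at n - l isolates block l: blocks l' > l vanish there by truncation, and blocks l'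
    -- < l have zero coefficients by induction.
    have h := congrArg Subtype.val (congrFun hz ⟨n - l, by omega⟩)
    rw [Finset.sum_apply, AddSubmonoidClass.coe_finsetSum, Fintype.sum_sigma,
      Finset.sum_eq_single ⟨l, hl⟩] at h
    · let x : ℤ → ℤ := fun t => if ht : t.toNat < Nat.totient (p ^ (n - l)) then
        z ⟨⟨l, hl⟩, ⟨t.toNat, ht⟩⟩ else 0
      have hx : ∀ j : Fin (Nat.totient (p ^ (n - l))), x (j : ℕ) = z ⟨⟨l, hl⟩, j⟩ := fun j => by
        simp [x]
      rw [← hx]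
      refine coords_eq_zero (pow_pos hp.pos _) (hζ (n - l) (Nat.sub_le _ _)) ?_ j.2
      rw [← Fin.sum_univ_eq_sum_range (fun j => (x j : K) * ζ (n - l) ^ j)]
      rw [Pi.zero_apply, ZeroMemClass.coe_zero] at h
      rw [← h]
      refine Finset.sum_congr rfl fun j _ => ?_
      rw [hx, Pi.smul_apply, SetLike.val_smul, coe_truncPow, if_pos le_rfl, zsmul_eq_mul]
    · rintro ⟨l', hl'⟩ _ hne
      have hne' : l' ≠ l := fun h => hne (Fin.ext h)
      refine Finset.sum_eq_zero fun j _ => ?_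
      rcases hne'.lt_or_gt with hlt | hgt
      · rw [ih l' hlt]
        simp
      · rw [Pi.smul_apply, SetLike.val_smul, coe_truncPow, if_neg (by simp only; omega), smul_zero]
    · simp

variable {G : Type*} [Group G] {c : G}

theorem normElt_periodic (hcn : c ^ p ^ n = 1) {m : ℕ} (hm : m ≤ n) (j : ℕ) :
    normElt p n c m (j + p ^ m) = normElt p n c m j := by
  have h1 := Finset.sum_range_succ
    (fun s => MonoidAlgebra.of ℤ G (c ^ (j + p ^ m * s))) (p ^ (n - m))
  rw [Finset.sum_range_succ', ← pow_add, Nat.add_sub_cancel' hm, pow_add c j (p ^ n), hcn,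
    mul_one, mul_zero, add_zero, add_left_inj] at h1
  rw [normElt, normElt, ← h1]
  refine Finset.sum_congr rfl fun s _ => ?_
  congr 2
  ring

/-- The coset of exponents j + p^m ℤ splits into p cosets of p^(m+1) ℤ. -/
theorem sum_normElt {m : ℕ} (hm : m + 1 ≤ n) (j : ℕ) :
    ∑ k ∈ Finset.range p, normElt p n c (m + 1) (j + p ^ m * k) = normElt p n c m j := by
  have e : n - m = n - (m + 1) + 1 := by omega
  unfold normElt
  rw [Finset.sum_comm, e, pow_succ p (n - (m + 1)), mul_comm (p ^ (n - (m + 1))) p, sum_range_mul_eq]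
  refine Finset.sum_congr rfl fun s _ => Finset.sum_congr rfl fun k _ => ?_
  congr 2
  ring

/-- By periodicity j may be taken below p^m. An element of level m + 1 whose exponent p^m (p - 1) +
a lies in the last block is the level-m element with exponent a minus the elements of level m + 1
with exponents a + p^m k, k < p - 1, all in the admissible range. -/
theorem normElt_mem_span (hp : p.Prime) (hcn : c ^ p ^ n = 1) {S : Submodule ℤ (MonoidAlgebra ℤ G)}
    (hS : ∀ m ≤ n, ∀ j < (p ^ m).totient, normElt p n c m j ∈ S) :
    ∀ m ≤ n, ∀ j, normElt p n c m j ∈ S := by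
  have hmod : ∀ m ≤ n, ∀ j, normElt p n c m (j % p ^ m) = normElt p n c m j := fun m hm j =>
    (show Function.Periodic (normElt p n c m) (p ^ m) from normElt_periodic hcn hm).map_mod_nat j
  intro m
  induction m with
  | zero =>
    intro hm j
    rw [← hmod 0 hm, pow_zero, Nat.mod_one]
    exact hS 0 hm 0 (by simp)
  | succ m ih =>
    intro hm j
    rw [← hmod (m + 1) hm]
    set r := j % p ^ (m + 1) with hr
    have hr' : r < p ^ (m + 1) := Nat.mod_lt _ (pow_pos hp.pos _)
    by_cases hlt : r < (p ^ (m + 1)).totient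
    · exact hS _ hm _ hlt
    have ht := Nat.totient_prime_pow_succ hp m
    have hp1 : p - 1 + 1 = p := Nat.sub_add_cancel hp.one_le
    obtain ⟨a, ha⟩ := Nat.exists_eq_add_of_le (not_lt.1 hlt)
    have haq : a < p ^ m := by
      have : p ^ (m + 1) = p ^ m * (p - 1) + p ^ m := by rw [← mul_add_one, hp1, pow_succ]
      omega
    have hs := sum_normElt (p := p) (c := c) hm a
    rw [← hp1, Finset.sum_range_succ, hp1, ← eq_sub_iff_add_eq'] at hs
    rw [ha, ht, add_comm _ a, hs]
    refine sub_mem (ih (by omega) a) (Submodule.sum_mem _ fun k hk => hS _ hm _ ?_)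
    rw [ht]
    have hk' : k + 1 ≤ p - 1 := Finset.mem_range.1 hk
    calc a + p ^ m * k < p ^ m * (k + 1) := by rw [mul_add_one]; omega
      _ ≤ _ := Nat.mul_le_mul_left _ hk'

theorem span_normElt (hp : p.Prime) (hc : ∀ g : G, g ∈ Subgroup.zpowers c)
    (hG : Nat.card G = p ^ n) :
    ⊤ ≤ Submodule.span ℤ (Set.range
      fun a : (i : Fin (n + 1)) × Fin (Nat.totient (p ^ (n - (i : ℕ)))) =>
        normElt p n c (n - a.1) a.2) := by
  intro g _
  have hcn : c ^ p ^ n = 1 := hG ▸ pow_card_eq_one'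
  have key := normElt_mem_span hp hcn (S := Submodule.span ℤ (Set.range
      fun a : (i : Fin (n + 1)) × Fin (Nat.totient (p ^ (n - (i : ℕ)))) =>
        normElt p n c (n - a.1) a.2)) fun m hm j hj => by
    have hm' := Nat.sub_sub_self hm
    refine Submodule.subset_span ⟨⟨⟨n - m, by omega⟩, ⟨j, ?_⟩⟩, ?_⟩
    · simpa only [hm'] using hj
    · simp only [hm']
  induction g using MonoidAlgebra.induction_on with
  | of g =>
    obtain ⟨t, rfl⟩ := exists_pow_eq hp hc hG g
    -- At level n the norm sum has the single term c^t.
    simpa [normElt] using key n le_rfl t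
  | add x y hx hy => exact add_mem (hx trivial) (hy trivial)
  | smul r x hx => exact Submodule.smul_mem _ _ (hx trivial)

theorem hasElementaryDivisors_wedderburn (hp : p.Prime)
    (hζ : ∀ i ≤ n, IsPrimitiveRoot (ζ i) (p ^ i))
    (hc : ∀ g : G, g ∈ Subgroup.zpowers c) (hG : Nat.card G = p ^ n) :
    HasElementaryDivisors (wedderburn hp hζ hc hG).toLinearMap
      (fun a : (i : Fin (n + 1)) × Fin (Nat.totient (p ^ (n - (i : ℕ)))) =>
        (p : ℤ) ^ (a.1 : ℕ)) := by
  have hw : ∀ a : (i : Fin (n + 1)) × Fin (Nat.totient (p ^ (n - (i : ℕ)))),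
      wedderburn hp hζ hc hG (normElt p n c (n - a.1) a.2) =
        (p : ℤ) ^ (a.1 : ℕ) • truncPow n ζ (n - a.1) a.2 := fun a => by
    rw [wedderburn_normElt hp hζ hc hG (Nat.sub_le _ _),
      Nat.sub_sub_self (Nat.lt_succ_iff.mp a.1.2)]
  have hv := linearIndependent_truncPow hp hζ
  -- Independence is inherited from the images, which are nonzero multiples of independent vectors.
  have hu : LinearIndependent ℤ
      fun a : (i : Fin (n + 1)) × Fin (Nat.totient (p ^ (n - (i : ℕ)))) =>
        normElt p n c (n - a.1) a.2 := by
    rw [Fintype.linearIndependent_iff] at hv ⊢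
    intro z hz a
    have h := congrArg (wedderburn hp hζ hc hG) hz
    simp only [map_sum, map_smul, hw, smul_smul, map_zero] at h
    exact (mul_eq_zero.1 (hv _ h a)).resolve_right
      (pow_ne_zero _ (Int.natCast_ne_zero.2 hp.ne_zero))
  refine ⟨fun a b => (le_total (a.1 : ℕ) b.1).imp (pow_dvd_pow _) (pow_dvd_pow _),
    Module.Basis.mk hu (span_normElt hp hc hG), Module.Basis.mk hv (span_truncPow hp hζ),
    fun a => ?_⟩
  rw [Module.Basis.mk_apply, Module.Basis.mk_apply]
  exact hw a

end ElementaryDivisors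

/-! ### The description by the operators T -/

theorem finsum_eq_sum_Icc {p : ℕ} (hp : p.Prime) (m : ℕ) {x : ℤ →₀ ℤ}
    (hx : x.support ⊆ Finset.Icc 0 ((Nat.totient (p ^ (m + 1)) : ℤ) - 1)) {b : ℤ}
    (hb : b < 0) (hb' : -(p : ℤ) ^ m ≤ b) :
    ∑ᶠ k : ℤ, x (b + k * (p : ℤ) ^ m) =
      ∑ k ∈ Finset.Icc 1 (p - 1), x (b + (k : ℤ) * (p : ℤ) ^ m) := by
  have hq : (0 : ℤ) < (p : ℤ) ^ m := pow_pos (by exact_mod_cast hp.pos) m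
  rw [finsum_eq_sum_of_support_subset (s := (Finset.Icc 1 (p - 1)).map Nat.castEmbedding),
    Finset.sum_map]
  · rfl
  -- A nonzero term has 0 ≤ b + k p^m < p^(m+1) - p^m. With -p^m ≤ b < 0 this forces 0 < k < p.
  · intro k hk
    obtain ⟨h0, h1⟩ := Finset.mem_Icc.1 (hx (Finsupp.mem_support_iff.2 hk))
    rw [Nat.totient_prime_pow_succ hp] at h1
    have h1' : k * (p : ℤ) ^ m < p * (p : ℤ) ^ m := by
      have : ((p ^ m * (p - 1) : ℕ) : ℤ) = p * (p : ℤ) ^ m - (p : ℤ) ^ m := by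
        rw [Nat.cast_mul, Nat.cast_sub hp.one_le]
        push_cast
        ring
      linarith
    have hk1 : k < p := lt_of_mul_lt_mul_right h1' hq.le
    have hk0 : 0 < k := pos_of_mul_pos_left (by linarith : 0 < k * (p : ℤ) ^ m) hq.le
    simp only [Finset.coe_map, Set.mem_image, Finset.mem_coe, Finset.mem_Icc]
    exact ⟨k.toNat, by omega, Int.toNat_of_nonneg hk0.le⟩

/-- The right hand side of the ties in terms of the operators `T_i^{m,s}`. -/
theorem opT_sum_eq_tieSum {p n : ℕ} (hp : p.Prime) {x : ℕ → (ℤ →₀ ℤ)}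
    (hx : ∀ i ≤ n, (x i).support ⊆ Finset.Icc 0 ((Nat.totient (p ^ i) : ℤ) - 1)) {l : ℕ}
    (hl : l ≤ n) {j : ℤ} (h0 : 0 ≤ j) (h1 : j < (p : ℤ) ^ (n - l)) :
    (∑ i ∈ Finset.range l, (p : ℤ) ^ (l - 1 - i) •
        (opT p 0 (l - 1 - i) (n - l) (x (n - i)) - opT p 1 (l - 1 - i) (n - l) (x (n - i)))) j =
      tieSum p n (fun i => x i) l j := by
  have hpz : (1 : ℤ) ≤ p := by exact_mod_cast hp.one_le
  have hj : j ∈ Finset.Icc 0 ((p : ℤ) ^ (n - l) - 1) := Finset.mem_Icc.2 (by omega)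
  rw [Finsupp.finsetSum_apply, tieSum]
  refine Finset.sum_congr rfl fun i hi => ?_
  have hi := Finset.mem_range.1 hi
  have e : n - l + (l - 1 - i) = n - 1 - i := by omega
  have hx' : (x (n - i)).support ⊆
      Finset.Icc 0 ((Nat.totient (p ^ (n - 1 - i + 1)) : ℤ) - 1) := by
    rw [show n - 1 - i + 1 = n - i by omega]
    exact hx _ (Nat.sub_le _ _)
  have hsum : ∀ b : ℤ, b < 0 → -(p : ℤ) ^ (n - l) ≤ b → ∑ᶠ k : ℤ,
      x (n - i) (b + k * (p : ℤ) ^ (n - 1 - i)) =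
        ∑ k ∈ Finset.Icc 1 (p - 1), x (n - i) (b + (k : ℤ) * (p : ℤ) ^ (n - 1 - i)) :=
    fun b hb hb' => finsum_eq_sum_Icc hp _ hx' hb
      ((neg_le_neg (pow_le_pow_right₀ hpz (by omega))).trans hb')
  rw [Finsupp.smul_apply, Finsupp.sub_apply, smul_eq_mul, Finset.sum_sub_distrib, opT, opT,
    Finsupp.onFinset_apply, Finsupp.onFinset_apply, if_pos ⟨Nat.zero_le _, hj⟩, e, Nat.sub_zero,
    Int.emod_eq_of_lt h0 h1, hsum _ (by linarith) (by linarith)]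
  congr 2
  -- For l = n the operator T_0^{1,s} is zero by definition, matching the absent second term.
  by_cases h : l = n
  · rw [if_neg fun h' => by omega]
    simp [h]
  · have hq : (0 : ℤ) < (p : ℤ) ^ (n - l - 1) := pow_pos (by linarith) _
    have h2 := Int.emod_nonneg j hq.ne'
    have h3 := Int.emod_lt_of_pos j hq
    have hle : (p : ℤ) ^ (n - l - 1) ≤ (p : ℤ) ^ (n - l) := pow_le_pow_right₀ hpz (by omega)
    simp only [if_neg h]
    rw [if_pos ⟨by omega, hj⟩, hsum _ (by linarith) (by linarith)]

theorem opT_eq_zero {p m s i : ℕ} (x : ℤ →₀ ℤ) {j : ℤ} (h : ¬(0 ≤ j ∧ j < (p : ℤ) ^ i)) :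
    opT p m s i x j = 0 := by
  rw [opT, Finsupp.onFinset_apply, if_neg]
  rintro ⟨_, h'⟩
  have := Finset.mem_Icc.1 h'
  omega

/-- On the last block φ(p^(n-l)) ≤ j < p^(n-l) the two indices in each summand coincide. Thus the
entrywise congruences there read 0 ≡ 0 and add nothing to the ties. -/
theorem tieSum_eq_zero {p n : ℕ} (hp : p.Prime) (x : ℕ → ℤ → ℤ) {l : ℕ} (hl : l ≤ n) {j : ℤ}
    (h0 : (p ^ (n - l)).totient ≤ j) (h1 : j < (p : ℤ) ^ (n - l)) :
    tieSum p n x l j = 0 := by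
  rcases hl.eq_or_lt with rfl | hl
  · simp at h0 h1
    omega
  obtain ⟨d, hd⟩ : ∃ d, n - l = d + 1 := ⟨n - l - 1, by omega⟩
  rw [hd] at h0 h1
  have hs : ((p ^ (d + 1)).totient : ℤ) = (p : ℤ) ^ (d + 1) - (p : ℤ) ^ d := by
    rw [Nat.totient_prime_pow_succ hp, Nat.cast_mul, Nat.cast_sub hp.one_le]
    push_cast
    ring
  have hmod : j % (p : ℤ) ^ d = j - (p : ℤ) ^ (d + 1) + (p : ℤ) ^ d := by
    have e : j = j - (p : ℤ) ^ (d + 1) + (p : ℤ) ^ d + (p : ℤ) ^ d * (p - 1) := by ring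
    conv_lhs => rw [e, Int.add_mul_emod_self_left]
    exact Int.emod_eq_of_lt (by linarith) (by linarith)
  refine Finset.sum_eq_zero fun i _ => mul_eq_zero_of_right _ (Finset.sum_eq_zero fun k _ => ?_)
  rw [if_neg hl.ne, hd, Nat.add_sub_cancel, hmod, add_sub_cancel_right, sub_self]

theorem seqEval_eq_sum {K : Type*} [Field K] {x : ℤ →₀ ℤ} {N : ℕ}
    (hx : x.support ⊆ Finset.Icc 0 ((N : ℤ) - 1)) (z : K) :
    seqEval x z = ∑ j ∈ Finset.range N, (x j : K) * z ^ j := by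
  rw [seqEval, Finsupp.sum_of_support_subset (s := (Finset.range N).map Nat.castEmbedding),
    Finset.sum_map]
  · simp
  · intro j hj
    have := Finset.mem_Icc.1 (hx hj)
    exact Finset.mem_map.2 ⟨j.toNat, Finset.mem_range.2 (by omega), Int.toNat_of_nonneg this.1⟩
  · simp

theorem tieSetT_eq_tieSet {K : Type*} [Field K] {p n : ℕ} (hp : p.Prime) (ζ : ℕ → K) :
    tieSetT p n ζ = tieSet p n ζ := by
  ext y
  constructor
  · rintro ⟨x, hx, hy, htie⟩
    refine ⟨fun i => x i, fun i => ?_, fun l hl j hj => ?_⟩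
    · rw [hy, seqEval_eq_sum (hx i (Nat.lt_succ_iff.mp i.2))]
    · rw [← opT_sum_eq_tieSum hp hx (Finset.mem_Icc.1 hl).2 (Int.natCast_nonneg j)]
      · exact htie l hl j
      · exact_mod_cast (Finset.mem_range.1 hj).trans_le (Nat.totient_le _)
  · rintro ⟨x, hy, htie⟩
    -- Coefficients outside [0, φ(p^i) - 1] are unconstrained in `tieSet`; cutting them off changes
    -- neither the tuple nor, by `tieSum_congr`, the ties.
    let x' : ℕ → (ℤ →₀ ℤ) := fun i =>
      Finsupp.indicator (Finset.Icc 0 ((Nat.totient (p ^ i) : ℤ) - 1)) fun j _ => x i j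
    have hx' : ∀ i, ∀ j ∈ Finset.range (p ^ i).totient, x' i j = x i j := fun i j hj =>
      Finsupp.indicator_of_mem
        (Finset.mem_Icc.2 (by have := Finset.mem_range.1 hj; omega)) fun j _ => x i j
    have hsupp : ∀ i ≤ n, (x' i).support ⊆ Finset.Icc 0 ((Nat.totient (p ^ i) : ℤ) - 1) :=
      fun i _ => Finsupp.support_indicator_subset _ _
    have hx0 : ∀ i, ∀ j : ℤ, ¬(0 ≤ j ∧ j < (p ^ i).totient) → x' i j = 0 := fun i j hj =>
      Finsupp.indicator_of_notMem (fun h => hj (by have := Finset.mem_Icc.1 h; omega)) _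
    refine ⟨x', hsupp, fun i => ?_, fun l hl j => ?_⟩
    · rw [hy, seqEval_eq_sum (hsupp i (Nat.lt_succ_iff.mp i.2))]
      exact Finset.sum_congr rfl fun j hj => by rw [hx' i j hj]
    · have hln := (Finset.mem_Icc.1 hl).2
      have hle : ((p ^ (n - l)).totient : ℤ) ≤ (p : ℤ) ^ (n - l) := by
        exact_mod_cast Nat.totient_le _
      by_cases hj : 0 ≤ j ∧ j < (p : ℤ) ^ (n - l)
      · rw [opT_sum_eq_tieSum hp hsupp hln hj.1 hj.2]
        by_cases hφ : j < (p ^ (n - l)).totient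
        · obtain ⟨j, rfl⟩ := Int.eq_ofNat_of_zero_le hj.1
          have hjr := Finset.mem_range.2 (Int.ofNat_lt.1 hφ)
          rw [hx' _ _ hjr, tieSum_congr hp hln (by exact_mod_cast hj.2)
            (fun m _ j' hj' => hx' m j' hj')]
          exact htie l hl j hjr
        · rw [hx0 _ _ fun h => hφ h.2, tieSum_eq_zero hp _ hln (not_lt.1 hφ) hj.2]
      · rw [hx0 _ _ fun h => hj ⟨h.1, h.2.trans_le hle⟩, Finsupp.finsetSum_apply,
          Finset.sum_eq_zero]
        intro i _
        rw [Finsupp.smul_apply, Finsupp.sub_apply, opT_eq_zero _ hj, opT_eq_zero _ hj, sub_zero,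
          smul_zero]

theorem mainTheorem4 {K : Type*} [Field K] [CharZero K] {G : Type*} [Group G]
    (p n : ℕ) (hp : p.Prime)
    (c : G) (hc : ∀ g : G, g ∈ Subgroup.zpowers c) (hG : Nat.card G = p ^ n)
    (ζ : ℕ → K) (hζ : ∀ i ≤ n, IsPrimitiveRoot (ζ i) (p ^ i)) :
    -- the two descriptions of the image
    Set.range (wedderburn hp hζ hc hG) = tieSet p n ζ ∧
    Set.range (wedderburn hp hζ hc hG) = tieSetT p n ζ ∧
    -- triangular shape: the tie for `x_{n-l,j}` involves only coefficients of higher levels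
    (∀ l ∈ Finset.Icc 1 n, ∀ j ∈ Finset.range (Nat.totient (p ^ (n - l))), ∀ x x' : ℕ → ℤ → ℤ,
      (∀ m ∈ Finset.Icc (n - l + 1) n, ∀ j' ∈ Finset.range (Nat.totient (p ^ m)),
        x m j' = x' m j') →
      tieSum p n x l j = tieSum p n x' l j) ∧
    -- the elementary divisors: `p^i` with multiplicity `φ(p^{n-i})`, for `i ∈ [0,n]`
    HasElementaryDivisors (wedderburn hp hζ hc hG).toLinearMap
      (fun a : (i : Fin (n + 1)) × Fin (Nat.totient (p ^ (n - (i : ℕ)))) =>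
        (p : ℤ) ^ (a.1 : ℕ)) := by
  refine ⟨range_eq_tieSet hp hζ hc hG,
    (range_eq_tieSet hp hζ hc hG).trans (tieSetT_eq_tieSet hp ζ).symm,
    fun l hl j hj x x' h => ?_, hasElementaryDivisors_wedderburn hp hζ hc hG⟩
  exact tieSum_congr hp (Finset.mem_Icc.1 hl).2
    ((Finset.mem_range.1 hj).trans_le (Nat.totient_le _)) h
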